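/- Let $\mathcal Z$ be a measurable space, $\mathcal H$ a set of decisions, $L$ an arbitrary map from finite lists of points of $\mathcal Z$ to $\mathcal H$ (the synthesis algorithm), $h_0\in\mathcal H$ an initial decision, and $\varphi:\mathcal H\times\mathcal Z\to\{0,1\}$. Let $\mathtt{Stop}$ be an additional element not in $\mathcal Z$, and for every finite list $T$ of points of $\mathcal Z$ let $\le_T$ be a total order on $\mathcal Z\cup\{\mathtt{Stop}\}$. Given a list $D$ of points of $\mathcal Z$, the algorithm P2L$^+$ starts with $T=\emptyset$, $h=h_0$; as long as some $z\in D\setminus T$ satisfies $\mathtt{Stop}\le_T z$, it appends the $\le_T$-maximal element of $D\setminus T$ to $T$ and sets $h=L(T)$. (Here $D\setminus T$ is the list obtained from $D$ by removing the elements of $T$, counted with repetitions.) When the loop ends, it lets $U$ be the list of those $z\in D\setminus T$ with $\varphi(h,z)=0$ and returns $\text{P2L}^+(D)=(h,T,U)$. Let $z_1,\dots,z_N$ be i.i.d. random elements of $\mathcal Z$ with distribution $\mathbb P_z$, defined on a probability space with probability $\mathbb P$. Assume that the ingredients are measurable: the set $\{z:\varphi(h_0,z)=0\}$ and, for every $k$,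 the sets $\{(t,z)\in\mathcal Z^k\times\mathcal Z:\varphi(L(t),z)=0\}$, $\{(t,x,y)\in\mathcal Z^k\times\mathcal Z\times\mathcal Z: x\le_t y\}$ and $\{(t,z)\in\mathcal Z^k\times\mathcal Z:\mathtt{Stop}\le_t z\}$ are measurable. Let $R(h)=\mathbb P_z\{z:\varphi(h,z)=0\}$ be the risk of $h\in\mathcal H$. Let $\delta\in(0,1)$. Then for every $k=0,1,\dots,N-1$ the equation $\Psi_{k,\delta}(\varepsilon)=1$, where $$\Psi_{k,\delta}(\varepsilon)=\frac{\delta}{N}\sum_{m=k}^{N-1}\frac{\binom mk}{\binom Nk}(1-\varepsilon)^{-(N-m)},$$ has exactly one solution in $[k/N,1)$. Let $\bar\varepsilon(k,\delta,N)$ be this solution, and let $\bar\varepsilon(N,\delta,N)=1$. If $(h,T,U)=\text{P2L}^+(z_1,\dots,z_N)$, then $$\mathbb P\{R(h)\le\bar\varepsilon(|T|+|U|,\delta,N)\}\ge 1-\delta .$$ -/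

import Mathlib

open MeasureTheory ProbabilityTheory

namespace P2L

/-- A nonempty list has an element that is maximal for a given total order on `Z ∪ {Stop}`. Here
and below `Option Z` is `Z ∪ {Stop}`: `some z` is the point `z` and `none` is `Stop`. -/
theorem exists_max {Z : Type*} (o : LinearOrder (Option Z)) (l : List Z) (hl : l ≠ []) :
    ∃ z ∈ l, ∀ y ∈ l, o.le (some y) (some z) := by
  induction l with
  | nil => exact absurd rfl hl
  | cons a l ih =>
    by_cases h : l = []
    · subst h
      exact ⟨a, by simp, by simp⟩
    · obtain ⟨z, hz, hmax⟩ := ih h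
      rcases o.le_total (some a) (some z) with haz | hza
      · refine ⟨z, List.mem_cons_of_mem _ hz, fun y hy => ?_⟩
        rcases List.mem_cons.1 hy with rfl | hy
        · exact haz
        · exact hmax y hy
      · refine ⟨a, List.mem_cons_self, fun y hy => ?_⟩
        rcases List.mem_cons.1 hy with rfl | hy
        · exact o.le_refl _
        · exact o.le_trans _ _ _ (hmax y hy) hza

/-- The maximal element of a nonempty list of points (unique, by antisymmetry of the order). -/
noncomputable def maxElem {Z : Type*} (o : LinearOrder (Option Z)) (l : List Z) (hl : l ≠ []) : Z :=
  Classical.choose (exists_max o l hl)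

theorem maxElem_mem {Z : Type*} (o : LinearOrder (Option Z)) (l : List Z) (hl : l ≠ []) :
    maxElem o l hl ∈ l :=
  (Classical.choose_spec (exists_max o l hl)).1

theorem ne_nil_of_exists {Z : Type*} {l : List Z} {p : Z → Prop} (h : ∃ z ∈ l, p z) : l ≠ [] := by
  rintro rfl
  simp at h

open scoped Classical in
theorem length_diff_append_lt {Z : Type*} (D T : List Z) (z : Z) (hz : z ∈ D.diff T) :
    (D.diff (T ++ [z])).length < (D.diff T).length := by
  rw [List.diff_append, List.diff_cons, List.diff_nil, List.length_erase_of_mem hz]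
  have := List.length_pos_of_mem hz
  omega

open scoped Classical in
/-- The main loop, with current decision `h` and current training list `T`. While some point of
`D \ T` satisfies `Stop ≤_T z`, append the `≤_T`-maximal point of `D \ T` to `T` and redesign.
`List.diff D T` removes from `D` the elements of `T`, counted with repetitions. -/
noncomputable def loop {Z H : Type*} (L : List Z → H) (ord : List Z → LinearOrder (Option Z))
    (D : List Z) (h : H) (T : List Z) : H × List Z :=
  if hc : ∃ z ∈ D.diff T, (ord T).le none (some z) then
    loop L ord D
      (L (T ++ [maxElem (ord T) (D.diff T) (ne_nil_of_exists hc)]))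
      (T ++ [maxElem (ord T) (D.diff T) (ne_nil_of_exists hc)])
  else (h, T)
termination_by (D.diff T).length
decreasing_by exact length_diff_append_lt D T _ (maxElem_mem _ _ _)

open scoped Classical in
/-- The meta-algorithm P2L⁺ on the dataset `D`: the triple `(h, T, U)`. -/
noncomputable def p2lPlus {Z H : Type*} (L : List Z → H) (h₀ : H) (φ : H → Z → Fin 2)
    (ord : List Z → LinearOrder (Option Z)) (D : List Z) : H × List Z × List Z :=
  let r := loop L ord D h₀ []
  (r.1, r.2, (D.diff r.2).filter (fun z => φ r.1 z = 0))

/-- The risk `R(h)` of a decision: the probability that a new point violates `φ`. -/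
noncomputable def risk {Z H : Type*} [MeasurableSpace Z] (Pz : Measure Z) (φ : H → Z → Fin 2)
    (h : H) : ℝ :=
  Pz.real {z | φ h z = 0}

/-- `Ψ_{k,δ}(ε)` for sample size `N`; all `m` in the sum are `< N`, so `N - m` is exact. -/
noncomputable def Psi (k : ℕ) (δ : ℝ) (N : ℕ) (ε : ℝ) : ℝ :=
  δ / N * ∑ m ∈ Finset.Ico k N, (m.choose k : ℝ) / (N.choose k : ℝ) * ((1 - ε) ^ (N - m))⁻¹

/-- `ε` solves `Ψ_{k,δ}(ε) = 1` in `[k/N, 1]`. At `ε = 1`, where the function has a pole, the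
formula evaluates to `0`, so that the end point `1` is never a solution. -/
def IsRoot (k : ℕ) (δ : ℝ) (N : ℕ) (ε : ℝ) : Prop :=
  ε ∈ Set.Icc ((k : ℝ) / N) 1 ∧ Psi k δ N ε = 1

/-- `ε̄(k, δ, N)`: the solution of `Ψ_{k,δ}(ε) = 1` in `[k/N, 1]` for `k < N`, and `1` for `k = N`. -/
noncomputable def epsBar (k : ℕ) (δ : ℝ) (N : ℕ) : ℝ :=
  if k = N then 1 else sInf {ε | IsRoot k δ N ε}

end P2L

namespace P2L

/-! Attach to every sample point an independent mark with an atomless law, and break ties in `≤_T`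
by the marks. Almost surely a run on `m` marked points then selects exactly one injection of
positions. Given the selected marked points `t`, `a` in number, the other `m - a` points are
independent, and each must lie in a reject set that depends on `t` but not on `m`. With `ρ(t)` the
mass of that set, selecting `a` points has probability `(m)_a ∫ ρ(t)^(m-a)`, integrated over the `t`
that select themselves. For every `m` these numbers, summed over `a`, give at most 1
(`sum_descFactorial_mul_lintegral_le_one`).

At size `N`, split `ρ = p + q` according to whether a rejected point violates the decision (`p`) or
not (`q`). The event that `|T| = a`, `|U| = b` and the risk exceeds its bound has probability at
most `(N)_a C(N-a,b) ∫ p^b q^(N-a-b)` over the `t` with `R > ε̄(k)`, `k = a + b`. There `q ≤ 1 - R <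
1 - ε̄(k)`, and the equation `Ψ = 1` yields `C(N,k) q^(N-k) ≤ (δ/N) ∑_{m<N} C(m,k) q^(m-k)`
(`IsRoot.choose_mul_pow_le`). Multiplied by `(k)_a p^b` and summed over `b`, the right side becomes
`(δ/N) ∑_{m<N} (m)_a (p+q)^(m-a)` by the binomial theorem (`sum_descFactorial_le`). After
integration and summation over `a`, the failure probability at size `N` is at most `δ/N` times a sum
of `N` total probabilities at smaller sizes, hence at most `δ` (`measure_iUnion_exceedEvent_le`). -/

/-! ### The equation `Ψ = 1` and the scalar inequalities it gives. -/

theorem choose_div_choose_le {k N m : ℕ} (hk : k < N) (hkm : k ≤ m) (hm : m ≤ N) :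
    (m.choose k : ℝ) / N.choose k ≤ (1 - (k : ℝ) / N) ^ (N - m) := by
  have hN : (0 : ℝ) < N := by exact_mod_cast (by omega : 0 < N)
  have hkN : (k : ℝ) ≤ N := by exact_mod_cast hk.le
  have hq : (0 : ℝ) ≤ 1 - (k : ℝ) / N := by
    rw [sub_nonneg, div_le_one hN]; exact hkN
  rw [div_le_iff₀ (by exact_mod_cast Nat.choose_pos hk.le)]
  induction hm using Nat.decreasingInduction with
  | self => simp
  | of_succ m hm ih =>
    have ih := ih (by omega)
    have h1 : ((m + 1 : ℕ) : ℝ) * m.choose k = (m + 1).choose k * (((m + 1 : ℕ) : ℝ) - k) := by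
      have := Nat.add_one_mul_choose_eq m k
      have h2 := Nat.choose_succ_right_eq (m + 1) k
      rw [← this] at h2
      rw [← Nat.cast_sub (by omega)]
      exact_mod_cast h2
    have hm1 : (0 : ℝ) < ((m + 1 : ℕ) : ℝ) := by positivity
    -- The ratio of binomials telescopes into factors `1 - k/j` with `m < j ≤ N`, each at most `1 -
    -- k/N`.
    have h3 : (m.choose k : ℝ) = (m + 1).choose k * (1 - (k : ℝ) / ((m + 1 : ℕ) : ℝ)) := by
      field_simp
      linarith
    have h4 : 1 - (k : ℝ) / ((m + 1 : ℕ) : ℝ) ≤ 1 - (k : ℝ) / N := by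
      have : ((m + 1 : ℕ) : ℝ) ≤ N := by exact_mod_cast hm
      gcongr
    have h5 : N - m = (N - (m + 1)) + 1 := by omega
    rw [h3, h5, pow_succ]
    calc ((m + 1).choose k : ℝ) * (1 - (k : ℝ) / ((m + 1 : ℕ) : ℝ))
        ≤ (m + 1).choose k * (1 - (k : ℝ) / N) := by gcongr
      _ ≤ ((1 - (k : ℝ) / N) ^ (N - (m + 1)) * N.choose k) * (1 - (k : ℝ) / N) := by gcongr
      _ = _ := by ring

theorem Psi_lt_one {k N : ℕ} (hk : k < N) {δ : ℝ} (hδ₀ : 0 < δ) (hδ₁ : δ < 1) :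
    Psi k δ N ((k : ℝ) / N) < 1 := by
  have hN : (0 : ℝ) < N := by exact_mod_cast (by omega : 0 < N)
  have hkN : (k : ℝ) < N := by exact_mod_cast hk
  have hq : (0 : ℝ) < 1 - (k : ℝ) / N := by
    rw [sub_pos, div_lt_one hN]; exact hkN
  have h1 : ∑ m ∈ Finset.Ico k N,
      (m.choose k : ℝ) / (N.choose k : ℝ) * ((1 - (k : ℝ) / N) ^ (N - m))⁻¹ ≤ N := by
    calc _ ≤ ∑ m ∈ Finset.Ico k N, (1 : ℝ) := by
          refine Finset.sum_le_sum fun m hm => ?_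
          rw [Finset.mem_Ico] at hm
          rw [← div_eq_mul_inv, div_le_one (by positivity)]
          exact choose_div_choose_le hk hm.1 hm.2.le
      _ ≤ N := by
          rw [Finset.sum_const, Nat.card_Ico, nsmul_eq_mul, mul_one]
          exact_mod_cast Nat.sub_le N k
  calc Psi k δ N ((k : ℝ) / N) ≤ δ / N * N := by unfold Psi; gcongr
    _ = δ := by field_simp
    _ < 1 := hδ₁

theorem Psi_strictMonoOn {k N : ℕ} (hk : k < N) {δ : ℝ} (hδ₀ : 0 < δ) :
    StrictMonoOn (Psi k δ N) (Set.Iio 1) := by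
  have hN : (0 : ℝ) < N := by exact_mod_cast (by omega : 0 < N)
  intro x hx y hy hxy
  rw [Set.mem_Iio] at hx hy
  unfold Psi
  refine mul_lt_mul_of_pos_left ?_ (by positivity)
  refine Finset.sum_lt_sum_of_nonempty (Finset.nonempty_Ico.2 hk) fun m hm => ?_
  rw [Finset.mem_Ico] at hm
  have h1 : (0 : ℝ) < m.choose k := by exact_mod_cast Nat.choose_pos hm.1
  have h2 : (0 : ℝ) < N.choose k := by exact_mod_cast Nat.choose_pos hk.le
  have h3 : (0 : ℝ) < 1 - y := by linarith
  have h4 : N - m ≠ 0 := by omega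
  gcongr

theorem Psi_continuousOn (k N : ℕ) (δ : ℝ) : ContinuousOn (Psi k δ N) (Set.Iio 1) := by
  unfold Psi
  refine continuousOn_const.mul (continuousOn_finsetSum _ fun m _ => continuousOn_const.mul ?_)
  refine ContinuousOn.inv₀ (by fun_prop) fun x hx => ?_
  have : (0 : ℝ) < 1 - x := by rw [Set.mem_Iio] at hx; linarith
  positivity

theorem Psi_one {k N : ℕ} (δ : ℝ) : Psi k δ N 1 = 0 := by
  unfold Psi
  rw [Finset.sum_eq_zero, mul_zero]
  intro m hm
  rw [Finset.mem_Ico] at hm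
  have : N - m ≠ 0 := by omega
  simp [this]

theorem IsRoot.lt_one {k N : ℕ} {δ ε : ℝ} (h : IsRoot k δ N ε) : ε < 1 := by
  refine lt_of_le_of_ne h.1.2 ?_
  rintro rfl
  have := h.2
  rw [Psi_one] at this
  exact zero_ne_one this

theorem existsUnique_isRoot {k N : ℕ} (hk : k < N) {δ : ℝ} (hδ₀ : 0 < δ) (hδ₁ : δ < 1) :
    ∃! ε : ℝ, IsRoot k δ N ε := by
  have hN : (0 : ℝ) < N := by exact_mod_cast (by omega : 0 < N)
  have hkN : (k : ℝ) < N := by exact_mod_cast hk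
  have hk1 : (k : ℝ) / N < 1 := by rw [div_lt_one hN]; exact hkN
  have hmono := Psi_strictMonoOn hk hδ₀
  have hc1 : (0 : ℝ) < (N - 1).choose k := by exact_mod_cast Nat.choose_pos (by omega)
  have hc2 : (0 : ℝ) < N.choose k := by exact_mod_cast Nat.choose_pos hk.le
  -- With this `c`, the term `m = N - 1` alone makes `Ψ` reach 1 at `ε = 1 - c`.
  set c : ℝ := δ / N * ((N - 1).choose k / N.choose k) with hc
  have hcpos : 0 < c := by positivity
  have hlarge : 1 ≤ Psi k δ N (1 - c) := by
    have : (((N - 1).choose k : ℝ) / (N.choose k : ℝ)) * ((1 - (1 - c)) ^ (N - (N - 1)))⁻¹ ≤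
        ∑ m ∈ Finset.Ico k N,
          (m.choose k : ℝ) / (N.choose k : ℝ) * ((1 - (1 - c)) ^ (N - m))⁻¹ := by
      refine Finset.single_le_sum (f := fun m : ℕ =>
        (m.choose k : ℝ) / (N.choose k : ℝ) * ((1 - (1 - c)) ^ (N - m))⁻¹) (fun m _ => ?_)
        (Finset.mem_Ico.2 (by omega))
      rw [sub_sub_cancel]
      positivity
    have h1 : N - (N - 1) = 1 := by omega
    rw [h1, sub_sub_cancel, pow_one] at this
    calc (1 : ℝ) = δ / N * ((((N - 1).choose k : ℝ) / (N.choose k : ℝ)) * c⁻¹) := by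
          rw [← mul_assoc, ← hc, mul_inv_cancel₀ hcpos.ne']
      _ ≤ Psi k δ N (1 - c) := by
          unfold Psi
          rw [sub_sub_cancel] at *
          gcongr
  have hlt : (k : ℝ) / N < 1 - c := by
    rw [← hmono.lt_iff_lt hk1 (by simp [hcpos])]
    exact (Psi_lt_one hk hδ₀ hδ₁).trans_le hlarge
  obtain ⟨ε, hε, hεe⟩ := intermediate_value_Icc hlt.le
    ((Psi_continuousOn k N δ).mono fun x hx => by
      rw [Set.mem_Iio]; linarith [hx.2])
    ⟨(Psi_lt_one hk hδ₀ hδ₁).le, hlarge⟩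
  refine ⟨ε, ⟨⟨hε.1, by linarith [hε.2]⟩, hεe⟩, fun y hy => ?_⟩
  exact hmono.injOn hy.lt_one (by rw [Set.mem_Iio]; linarith [hε.2]) (hy.2.trans hεe.symm)

theorem isRoot_epsBar {k N : ℕ} (hk : k < N) {δ : ℝ} (hδ₀ : 0 < δ) (hδ₁ : δ < 1) :
    IsRoot k δ N (epsBar k δ N) := by
  obtain ⟨ε, hε, huniq⟩ := existsUnique_isRoot hk hδ₀ hδ₁
  have : {ε | IsRoot k δ N ε} = {ε} := by
    ext y
    exact ⟨fun hy => huniq y hy, fun hy => by rw [Set.mem_singleton_iff] at hy; rwa [hy]⟩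
  rw [epsBar, if_neg hk.ne, this, csInf_singleton]
  exact hε

/-- At `q = 1 - ε` this is the equation `Ψ = 1` with denominators cleared. Shrinking `q` by a factor
`s ≤ 1` costs the left side `s^(N-k)` and each right-hand term only `s^(m-k)`. The terms `m < k`
vanish. -/
theorem IsRoot.choose_mul_pow_le {k N : ℕ} (hk : k < N) {δ ε q : ℝ} (hδ₀ : 0 < δ)
    (hε : IsRoot k δ N ε) (hq₀ : 0 ≤ q) (hq : q ≤ 1 - ε) :
    (N.choose k : ℝ) * q ^ (N - k) ≤
      δ / N * ∑ m ∈ Finset.range N, (m.choose k : ℝ) * q ^ (m - k) := by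
  have hq1 : 0 < 1 - ε := by linarith [hε.lt_one]
  have hc2 : (0 : ℝ) < N.choose k := by exact_mod_cast Nat.choose_pos hk.le
  obtain ⟨s, hs0, hs1, rfl⟩ : ∃ s : ℝ, 0 ≤ s ∧ s ≤ 1 ∧ q = (1 - ε) * s :=
    ⟨q / (1 - ε), by positivity, by rwa [div_le_one hq1], by field_simp⟩
  have hsub : Finset.Ico k N ⊆ Finset.range N := fun m hm => by
    rw [Finset.mem_Ico] at hm; exact Finset.mem_range.2 hm.2
  calc (N.choose k : ℝ) * ((1 - ε) * s) ^ (N - k)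
      = Psi k δ N ε * ((N.choose k : ℝ) * ((1 - ε) * s) ^ (N - k)) := by rw [hε.2, one_mul]
    _ = δ / N * ∑ m ∈ Finset.Ico k N, (m.choose k : ℝ) * (1 - ε) ^ (m - k) * s ^ (N - k) := by
        unfold Psi
        rw [mul_assoc, Finset.sum_mul]
        congr 1
        refine Finset.sum_congr rfl fun m hm => ?_
        rw [Finset.mem_Ico] at hm
        have : N - k = (N - m) + (m - k) := by omega
        rw [mul_pow]
        nth_rewrite 1 [this]
        rw [pow_add]
        field_simp
    _ ≤ δ / N * ∑ m ∈ Finset.Ico k N, (m.choose k : ℝ) * ((1 - ε) * s) ^ (m - k) := by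
        refine mul_le_mul_of_nonneg_left (Finset.sum_le_sum fun m hm => ?_) (by positivity)
        rw [Finset.mem_Ico] at hm
        rw [mul_pow, ← mul_assoc]
        exact mul_le_mul_of_nonneg_left (pow_le_pow_of_le_one hs0 hs1 (by omega))
          (by positivity)
    _ ≤ _ := by
        exact mul_le_mul_of_nonneg_left
          (Finset.sum_le_sum_of_subset_of_nonneg hsub fun m _ _ => by positivity) (by positivity)

/-- Both sides count an ordered choice of `a` points together with an unordered choice of `b`
others. -/
theorem descFactorial_mul_choose (m a b : ℕ) :
    m.descFactorial a * (m - a).choose b = m.choose (a + b) * (a + b).descFactorial a := by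
  rcases lt_or_ge m (a + b) with h | h
  · rw [Nat.choose_eq_zero_of_lt h, zero_mul, mul_eq_zero]
    rcases lt_or_ge m a with h' | h'
    · exact Or.inl (Nat.descFactorial_eq_zero_iff_lt.2 h')
    · exact Or.inr (Nat.choose_eq_zero_of_lt (by omega))
  · have := Nat.choose_mul (n := m) (k := a + b) (s := a) (by omega)
    rw [Nat.add_sub_cancel_left] at this
    rw [Nat.descFactorial_eq_factorial_mul_choose, Nat.descFactorial_eq_factorial_mul_choose,
      mul_assoc, ← this]
    ring

theorem sum_descFactorial_le {N a : ℕ} {δ r p q : ℝ} (hδ₀ : 0 < δ) (hδ₁ : δ < 1)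
    (hp : 0 ≤ p) (hq : 0 ≤ q) (hqr : q ≤ 1 - r) (ha : a ≤ N) :
    ∑ b ∈ (Finset.range (N - a + 1)).filter (fun b => epsBar (a + b) δ N < r),
      (N.descFactorial a : ℝ) * ((N - a).choose b * (p ^ b * q ^ (N - a - b))) ≤
    δ / N * ∑ m ∈ Finset.range N, (m.descFactorial a : ℝ) * (p + q) ^ (m - a) := by
  -- All `m` are expanded over one common range of `b`, the surplus binomial coefficients being
  -- zero, so that the comparison can be made for each `b` separately.
  have hexp : ∀ m ∈ Finset.range N, (m.descFactorial a : ℝ) * (p + q) ^ (m - a) =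
      ∑ b ∈ Finset.range (N - a + 1),
        (m.descFactorial a : ℝ) * ((m - a).choose b * (p ^ b * q ^ (m - a - b))) := by
    intro m hm
    rw [Finset.mem_range] at hm
    rw [add_pow, ← Finset.mul_sum]
    congr 1
    have hs : Finset.range (m - a + 1) ⊆ Finset.range (N - a + 1) :=
      Finset.range_mono (by omega)
    rw [← Finset.sum_subset hs]
    · exact Finset.sum_congr rfl fun b _ => by ring
    · intro b _ hb
      rw [Finset.mem_range, not_lt] at hb
      rw [Nat.choose_eq_zero_of_lt (by omega)]
      simp
  rw [Finset.sum_congr rfl hexp, Finset.sum_comm, Finset.mul_sum]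
  refine le_trans (Finset.sum_le_sum fun b hb => ?_)
    (Finset.sum_le_sum_of_subset_of_nonneg (Finset.filter_subset _ _) fun b _ _ => by positivity)
  rw [Finset.mem_filter, Finset.mem_range] at hb
  obtain ⟨hbN, hb⟩ := hb
  -- For `a + b = N` the bound is 1, and `1 < r` contradicts `0 ≤ q ≤ 1 - r`.
  rcases eq_or_ne (a + b) N with hN | hN
  · exfalso
    rw [epsBar, if_pos hN] at hb
    linarith
  have hk : a + b < N := by omega
  have hroot := isRoot_epsBar hk hδ₀ hδ₁
  have key := hroot.choose_mul_pow_le hk hδ₀ hq (by linarith)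
  have e : ∀ m : ℕ, (m.descFactorial a : ℝ) * ((m - a).choose b * (p ^ b * q ^ (m - a - b))) =
      ((a + b).descFactorial a : ℝ) * p ^ b * ((m.choose (a + b) : ℝ) * q ^ (m - (a + b))) := by
    intro m
    have := congrArg (Nat.cast (R := ℝ)) (descFactorial_mul_choose m a b)
    push_cast at this
    rw [← mul_assoc, this, Nat.sub_sub]
    ring
  simp only [e]
  rw [← Finset.mul_sum]
  exact (mul_le_mul_of_nonneg_left key (by positivity)).trans_eq (mul_left_comm _ _ _)

open scoped ENNReal in
theorem sum_descFactorial_le_ennreal {N a : ℕ} {δ r : ℝ} {p q : ℝ≥0∞} (hδ₀ : 0 < δ) (hδ₁ : δ < 1)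
    (hp : p ≠ ∞) (hq : q ≠ ∞) (hqr : q.toReal ≤ 1 - r) (ha : a ≤ N) :
    ∑ b ∈ (Finset.range (N - a + 1)).filter (fun b => epsBar (a + b) δ N < r),
      (N.descFactorial a : ℝ≥0∞) * ((N - a).choose b * (p ^ b * q ^ (N - a - b))) ≤
    ENNReal.ofReal (δ / N) *
      ∑ m ∈ Finset.range N, (m.descFactorial a : ℝ≥0∞) * (p + q) ^ (m - a) := by
  lift p to NNReal using hp
  lift q to NNReal using hq
  have key := sum_descFactorial_le (N := N) hδ₀ hδ₁ p.coe_nonneg q.coe_nonneg hqr ha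
  have hδ : δ / N = ((δ / N).toNNReal : ℝ) := (Real.coe_toNNReal _ (by positivity)).symm
  rw [hδ] at key
  rw [ENNReal.ofReal]
  exact_mod_cast key

/-! ### Product measures split along an injection. -/

section Pi
open scoped ENNReal

variable {X : Type*} [MeasurableSpace X] (μ : Measure X) [IsProbabilityMeasure μ]

theorem measurePreserving_embedding_split {a m : ℕ} (τ : Fin a ↪ Fin m) :
    MeasurePreserving
      (fun x : Fin m → X => ((fun i => x (τ i), fun j => x j) :
        (Fin a → X) × ({j : Fin m // j ∉ Set.range τ} → X)))
      (Measure.pi fun _ => μ) ((Measure.pi fun _ => μ).prod (Measure.pi fun _ => μ)) := by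
  classical
  let _ : Fintype {j : Fin m // j ∈ Set.range τ} := Subtype.fintype _
  have h1 := measurePreserving_piEquivPiSubtypeProd (fun _ : Fin m => μ) (· ∈ Set.range τ)
  have h2 := (measurePreserving_piCongrLeft (fun _ : {j : Fin m // j ∈ Set.range τ} => μ)
    (Equiv.ofInjective τ τ.injective)).symm
  exact (h2.prod (MeasurePreserving.id _)).comp h1

/-- Fubini: once the coordinates in the range of `τ` are fixed to `t`, the others are independent,
so the section is a box whose measure is a product. -/
theorem pi_embedding_event {a m : ℕ} (τ : Fin a ↪ Fin m) {A : Set (Fin a → X)}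
    (hA : MeasurableSet A) {C : {j : Fin m // j ∉ Set.range τ} → Set ((Fin a → X) × X)}
    (hC : ∀ j, MeasurableSet (C j)) :
    MeasurableSet {x : Fin m → X | (fun i => x (τ i)) ∈ A ∧
      ∀ j, ((fun i => x (τ i)), x (j : Fin m)) ∈ C j} ∧
    Measure.pi (fun _ : Fin m => μ) {x | (fun i => x (τ i)) ∈ A ∧
      ∀ j, ((fun i => x (τ i)), x (j : Fin m)) ∈ C j} =
    ∫⁻ t in A, ∏ j, μ (Prod.mk t ⁻¹' C j) ∂(Measure.pi fun _ => μ) := by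
  have hS : MeasurableSet {p : (Fin a → X) × ({j : Fin m // j ∉ Set.range τ} → X) |
      p.1 ∈ A ∧ ∀ j, (p.1, p.2 j) ∈ C j} := by
    refine (measurable_fst hA).inter ?_
    have : {p : (Fin a → X) × ({j : Fin m // j ∉ Set.range τ} → X) | ∀ j, (p.1, p.2 j) ∈ C j} =
        ⋂ j, (fun p : (Fin a → X) × ({j : Fin m // j ∉ Set.range τ} → X) => (p.1, p.2 j)) ⁻¹'
          C j := by ext; simp
    change MeasurableSet {p : (Fin a → X) × ({j : Fin m // j ∉ Set.range τ} → X) |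
      ∀ j, (p.1, p.2 j) ∈ C j}
    rw [this]
    exact MeasurableSet.iInter fun j => (by fun_prop : Measurable _) (hC j)
  have hmp := measurePreserving_embedding_split μ τ
  refine ⟨hmp.measurable hS, ?_⟩
  refine (hmp.measure_preimage hS.nullMeasurableSet).trans ?_
  rw [Measure.prod_apply hS, ← lintegral_indicator hA]
  refine lintegral_congr fun t => ?_
  by_cases ht : t ∈ A
  · rw [Set.indicator_of_mem ht, ← Measure.pi_pi]
    congr 1
    ext y
    simp [ht]
  · rw [Set.indicator_of_notMem ht]
    simp [ht]

theorem pi_coord_eq_null {ν : Measure X} (f : X → ℝ) (hf : Measurable f)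
    [IsProbabilityMeasure ν] (hν : ∀ c, ν (f ⁻¹' {c}) = 0) {m : ℕ} {i j : Fin m} (hij : i ≠ j) :
    Measure.pi (fun _ : Fin m => ν) {x | f (x i) = f (x j)} = 0 := by
  classical
  let τ : Fin 1 ↪ Fin m := ⟨fun _ => i, fun _ _ _ => Subsingleton.elim _ _⟩
  have hj : j ∉ Set.range τ := by
    rintro ⟨_, h⟩
    exact hij h
  let C : {l : Fin m // l ∉ Set.range τ} → Set ((Fin 1 → X) × X) :=
    fun l => if (l : Fin m) = j then {p | f (p.1 0) = f p.2} else Set.univ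
  have hC : ∀ l, MeasurableSet (C l) := by
    intro l
    dsimp only [C]
    split_ifs
    · exact measurableSet_eq_fun (by fun_prop) (by fun_prop)
    · exact MeasurableSet.univ
  have h := (pi_embedding_event ν τ MeasurableSet.univ hC).2
  refine measure_mono_null (t := {x | (fun i => x (τ i)) ∈ Set.univ ∧
      ∀ l, ((fun i => x (τ i)), x (l : Fin m)) ∈ C l}) ?_ (h.trans ?_)
  · intro x hx
    refine ⟨Set.mem_univ _, fun l => ?_⟩
    dsimp only [C]
    split_ifs with hl
    · rw [hl]; exact hx
    · exact Set.mem_univ _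
  · rw [lintegral_eq_zero_of_ae_eq_zero]
    refine Filter.Eventually.of_forall fun t => ?_
    refine Finset.prod_eq_zero (Finset.mem_univ ⟨j, hj⟩) ?_
    have : Prod.mk t ⁻¹' C ⟨j, hj⟩ = f ⁻¹' {f (t 0)} := by
      ext y
      simp [C, eq_comm]
    rw [this, hν]

theorem ae_injective_marks {ν : Measure X} (f : X → ℝ) (hf : Measurable f)
    [IsProbabilityMeasure ν] (hν : ∀ c, ν (f ⁻¹' {c}) = 0) (m : ℕ) :
    ∀ᵐ x ∂Measure.pi (fun _ : Fin m => ν), Function.Injective fun i => f (x i) := by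
  have : ∀ᵐ x ∂Measure.pi (fun _ : Fin m => ν), ∀ i j : Fin m, i ≠ j → f (x i) ≠ f (x j) := by
    simp only [ae_all_iff]
    intro i j hij
    rw [ae_iff]
    simpa using pi_coord_eq_null f hf hν hij
  filter_upwards [this] with x hx i j h
  by_contra hij
  exact hx i j hij h

end Pi

/-! ### Uniqueness of the selected positions. -/

section Selection

variable {Z H : Type*}

/-- The decision in force once the list `T` has been selected. -/
def decision (L : List Z → H) (h₀ : H) : List Z → H
  | [] => h₀
  | a :: l => L (a :: l)

/-- The points selected before step `s`. -/
def pre {a : ℕ} (t : Fin a → Z × ℝ) (s : Fin a) : List Z :=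
  List.ofFn fun i : Fin s => (t ⟨i, i.2.trans s.2⟩).1

/-- `x` does not come after `y` when ties in `≤_T` are broken by the marks. -/
def MarkedLE (o : LinearOrder (Option Z)) (x y : Z × ℝ) : Prop :=
  o.le (some x.1) (some y.1) ∧ (o.le (some y.1) (some x.1) → x.2 ≤ y.2)

/-- The marked points `t` are selected by the main loop, in this order, when no others are present
and the stopping rule is ignored after the last step. -/
def Selects (ord : List Z → LinearOrder (Option Z)) {a : ℕ} (t : Fin a → Z × ℝ) : Prop :=
  ∀ s : Fin a, (ord (pre t s)).le none (some (t s).1) ∧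
    ∀ s', s < s' → MarkedLE (ord (pre t s)) (t s') (t s)

/-- The point `x` is never selected in the run that selects `t`. -/
def Rejects (ord : List Z → LinearOrder (Option Z)) {a : ℕ} (t : Fin a → Z × ℝ) (x : Z × ℝ) :
    Prop :=
  (∀ s : Fin a, MarkedLE (ord (pre t s)) x (t s)) ∧
    ¬ (ord (List.ofFn fun i => (t i).1)).le none (some x.1)

/-- The run on the marked dataset `x` selects the indices `τ` in this order. -/
def RunSelects (ord : List Z → LinearOrder (Option Z)) {a m : ℕ} (x : Fin m → Z × ℝ)
    (τ : Fin a ↪ Fin m) : Prop :=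
  Selects ord (fun i => x (τ i)) ∧
    ∀ j : {j // j ∉ Set.range τ}, Rejects ord (fun i => x (τ i)) (x j)

/-- By induction both runs have the same training list at step `s`. Each one's choice is still
available to the other, being selected there later or rejected, so each is maximal against the other
and their marks agree. -/
theorem RunSelects.apply_eq {ord : List Z → LinearOrder (Option Z)} {a b m : ℕ}
    {x : Fin m → Z × ℝ} (hx : Function.Injective fun i => (x i).2)
    {τ : Fin a ↪ Fin m} {σ : Fin b ↪ Fin m} (hτ : RunSelects ord x τ) (hσ : RunSelects ord x σ)
    (s : ℕ) (hsa : s < a) (hsb : s < b) : τ ⟨s, hsa⟩ = σ ⟨s, hsb⟩ := by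
  induction s using Nat.strong_induction_on with
  | _ s ih =>
  have hpre : pre (fun i => x (τ i)) ⟨s, hsa⟩ = pre (fun i => x (σ i)) ⟨s, hsb⟩ := by
    unfold pre
    congr 1
    funext i
    dsimp only
    rw [ih i i.2]
  have key : ∀ {a b : ℕ} {τ : Fin a ↪ Fin m} {σ : Fin b ↪ Fin m}, RunSelects ord x τ →
      ∀ (hsa : s < a) (hsb : s < b),
      (∀ i (hi : i < s), τ ⟨i, hi.trans hsa⟩ = σ ⟨i, hi.trans hsb⟩) →
      MarkedLE (ord (pre (fun i => x (τ i)) ⟨s, hsa⟩)) (x (σ ⟨s, hsb⟩)) (x (τ ⟨s, hsa⟩)) := by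
    intro a b τ σ hτ hsa hsb hi
    by_cases hr : σ ⟨s, hsb⟩ ∈ Set.range τ
    · obtain ⟨s', hs'⟩ := hr
      rcases lt_trichotomy s' ⟨s, hsa⟩ with h | h | h
      · have := hi s' h
        have h2 : σ ⟨s', lt_trans h hsb⟩ = σ ⟨s, hsb⟩ := this.symm.trans hs'
        have h3 := congrArg Fin.val (σ.injective h2)
        exact absurd h3 (ne_of_lt h)
      · rw [← hs', h]
        exact ⟨(ord _).le_refl _, fun _ => le_rfl⟩
      · rw [← hs']
        exact (hτ.1 ⟨s, hsa⟩).2 s' h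
    · exact (hτ.2 ⟨_, hr⟩).1 ⟨s, hsa⟩
  have h1 := key hτ hsa hsb fun i hi => ih i hi _ _
  have h2 := key hσ hsb hsa fun i hi => (ih i hi _ _).symm
  rw [← hpre] at h2
  exact hx (le_antisymm (h2.2 h1.1) (h1.2 h2.1))

/-- If `σ` went on after `τ` stopped, its next point would be rejected by `τ`, hence below `Stop`
for the very list at which `σ` selects it. -/
theorem RunSelects.le {ord : List Z → LinearOrder (Option Z)} {a b m : ℕ}
    {x : Fin m → Z × ℝ} (hx : Function.Injective fun i => (x i).2)
    {τ : Fin a ↪ Fin m} {σ : Fin b ↪ Fin m} (hτ : RunSelects ord x τ) (hσ : RunSelects ord x σ) :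
    b ≤ a := by
  by_contra! hab
  have heq := fun s (hs : s < a) => hτ.apply_eq hx hσ s hs (hs.trans hab)
  have hr : σ ⟨a, hab⟩ ∉ Set.range τ := by
    rintro ⟨s, hs⟩
    have h1 : σ ⟨s, s.2.trans hab⟩ = σ ⟨a, hab⟩ := (heq s s.2).symm.trans hs
    exact absurd (congrArg Fin.val (σ.injective h1)) (ne_of_lt s.2)
  refine (hτ.2 ⟨_, hr⟩).2 ?_
  have hpre : pre (fun i => x (σ i)) ⟨a, hab⟩ = List.ofFn fun i => (x (τ i)).1 := by
    unfold pre
    congr 1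
    funext i
    dsimp only
    rw [← heq i i.2]
  rw [← hpre]
  exact (hσ.1 ⟨a, hab⟩).1

theorem RunSelects.unique {ord : List Z → LinearOrder (Option Z)} {m : ℕ}
    {x : Fin m → Z × ℝ} (hx : Function.Injective fun i => (x i).2)
    {p q : Σ a : ℕ, Fin a ↪ Fin m} (hp : RunSelects ord x p.2) (hq : RunSelects ord x q.2) :
    p = q := by
  obtain ⟨a, τ⟩ := p
  obtain ⟨b, σ⟩ := q
  obtain rfl : a = b := le_antisymm (hq.le hx hp) (hp.le hx hq)
  congr 1
  ext s : 1
  exact hp.apply_eq hx hq s s.2 s.2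

end Selection

/-! ### The actual loop realises a selection. -/

section Run

variable {Z H : Type*}

theorem le_maxElem (o : LinearOrder (Option Z)) (l : List Z) (hl : l ≠ []) {y : Z} (hy : y ∈ l) :
    o.le (some y) (some (maxElem o l hl)) :=
  (Classical.choose_spec (exists_max o l hl)).2 y hy

open scoped Classical in
theorem ofFn_diff_map_perm {N : ℕ} (z : Fin N → Z) {I : List (Fin N)} (hI : I.Nodup) :
    ((List.ofFn z).diff (I.map z)).Perm (((List.finRange N).filter (· ∉ I)).map z) := by
  have h1 : (List.finRange N).Perm (I ++ (List.finRange N).filter (· ∉ I)) := by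
    rw [List.perm_ext_iff_of_nodup (List.nodup_finRange N)
      (List.Nodup.append hI ((List.nodup_finRange N).filter _) ?_)]
    · intro i
      by_cases hi : i ∈ I <;> simp [hi]
    · intro i hi hi'
      simp [hi] at hi'
  rw [List.ofFn_eq_map]
  refine ((h1.map z).diff_right _).trans ?_
  rw [List.map_append, List.perm_iff_count]
  intro y
  rw [List.count_diff, List.count_append, Nat.add_sub_cancel_left]

open scoped Classical in
theorem mem_ofFn_diff_map {N : ℕ} (z : Fin N → Z) {I : List (Fin N)} (hI : I.Nodup) {y : Z} :
    y ∈ (List.ofFn z).diff (I.map z) ↔ ∃ i, i ∉ I ∧ z i = y := by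
  rw [(ofFn_diff_map_perm z hI).mem_iff]
  simp

/-- Every index in the list `I` was a legitimate choice of the main loop on `x`. -/
def IsTrace (ord : List Z → LinearOrder (Option Z)) {N : ℕ} (x : Fin N → Z × ℝ)
    (I : List (Fin N)) : Prop :=
  ∀ I₁ i I₂, I = I₁ ++ i :: I₂ →
    (ord (I₁.map fun l => (x l).1)).le none (some (x i).1) ∧
      ∀ j, j ∉ I₁ → MarkedLE (ord (I₁.map fun l => (x l).1)) (x j) (x i)

theorem decision_append (L : List Z → H) (h₀ : H) (T : List Z) (y : Z) :
    decision L h₀ (T ++ [y]) = L (T ++ [y]) := by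
  cases T <;> rfl

open scoped Classical in
-- The loop handles values while the probabilistic argument needs positions. This follows the loop
-- from a partial list of positions `I`, where `n` bounds the number of steps left.
theorem exists_trace (L : List Z → H) (h₀ : H) (ord : List Z → LinearOrder (Option Z)) {N : ℕ}
    (x : Fin N → Z × ℝ) (n : ℕ) :
    ∀ I : List (Fin N), I.Nodup → IsTrace ord x I → N ≤ I.length + n →
      ∃ I' : List (Fin N), I'.Nodup ∧ IsTrace ord x I' ∧
        (∀ j, j ∉ I' → ¬ (ord (I'.map fun l => (x l).1)).le none (some (x j).1)) ∧
        loop L ord (List.ofFn fun l => (x l).1) (decision L h₀ (I.map fun l => (x l).1))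
          (I.map fun l => (x l).1) =
            (decision L h₀ (I'.map fun l => (x l).1), I'.map fun l => (x l).1) := by
  induction n with
  | zero =>
    intro I hI hT hn
    have hall : ∀ j, j ∈ I := by
      intro j
      by_contra hj
      have := (List.nodup_cons.2 ⟨hj, hI⟩).length_le_card
      simp at this
      omega
    refine ⟨I, hI, hT, fun j hj => absurd (hall j) hj, ?_⟩
    rw [loop, dif_neg]
    rintro ⟨y, hy, -⟩
    obtain ⟨i, hi, -⟩ := (mem_ofFn_diff_map _ hI).1 hy
    exact hi (hall i)
  | succ n ih =>
    intro I hI hT hn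
    by_cases hc : ∃ y ∈ (List.ofFn fun l => (x l).1).diff (I.map fun l => (x l).1),
        (ord (I.map fun l => (x l).1)).le none (some y)
    · rw [loop, dif_pos hc]
      set y := maxElem (ord (I.map fun l => (x l).1)) _ (ne_nil_of_exists hc) with hy
      have hmem := maxElem_mem (ord (I.map fun l => (x l).1)) _ (ne_nil_of_exists hc)
      rw [← hy] at hmem
      have hmax : ∀ j, j ∉ I → (ord (I.map fun l => (x l).1)).le (some (x j).1) (some y) :=
        fun j hj => le_maxElem _ _ _ ((mem_ofFn_diff_map _ hI).2 ⟨j, hj, rfl⟩)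
      have hnext : (ord (I.map fun l => (x l).1)).le none (some y) := by
        obtain ⟨w, hw, hw'⟩ := hc
        exact (ord _).le_trans _ _ _ hw' (le_maxElem _ _ _ hw)
      obtain ⟨i₀, hi₀, hi₀y⟩ := (mem_ofFn_diff_map _ hI).1 hmem
      -- Several positions may carry the maximal value; the one with the largest mark is taken, as
      -- `MarkedLE` requires.
      obtain ⟨i, hi, himax⟩ := Finset.exists_max_image
        (Finset.univ.filter fun j => j ∉ I ∧ (x j).1 = y) (fun j => (x j).2)
        ⟨i₀, by simp [hi₀, hi₀y]⟩
      rw [Finset.mem_filter] at hi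
      obtain ⟨-, hiI, hiy⟩ := hi
      have hmap : (I.map fun l => (x l).1) ++ [y] = (I ++ [i]).map fun l => (x l).1 := by
        simp [hiy]
      have hnd : (I ++ [i]).Nodup := by
        rw [List.nodup_append]
        refine ⟨hI, List.nodup_singleton i, fun u hu v hv => ?_⟩
        rw [List.mem_singleton] at hv
        rintro rfl
        exact hiI (hv ▸ hu)
      rw [← decision_append L h₀, hmap]
      refine ih (I ++ [i]) hnd ?_ (by simp; omega)
      intro I₁ i' I₂ h
      rcases List.eq_nil_or_concat I₂ with rfl | ⟨I₃, w, rfl⟩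
      · obtain ⟨rfl, h2⟩ := List.append_inj' h rfl
        obtain rfl : i = i' := by simpa using h2
        rw [hiy]
        refine ⟨hnext, fun j hj => ⟨?_, fun hle => ?_⟩⟩
        · rw [hiy]; exact hmax j hj
        · rw [hiy] at hle
          have := (ord _).le_antisymm _ _ (hmax j hj) hle
          exact himax j (by simpa using ⟨hj, Option.some.inj this⟩)
      · rw [List.concat_eq_append, ← List.cons_append, ← List.append_assoc] at h
        exact hT I₁ i' I₃ (List.append_inj' h rfl).1
    · refine ⟨I, hI, hT, fun j hj hle => hc ⟨_, (mem_ofFn_diff_map _ hI).2 ⟨j, hj, rfl⟩, hle⟩, ?_⟩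
      rw [loop, dif_neg hc]

theorem exists_runSelects (L : List Z → H) (h₀ : H) (φ : H → Z → Fin 2)
    (ord : List Z → LinearOrder (Option Z)) {N : ℕ} (x : Fin N → Z × ℝ) :
    ∃ (a : ℕ) (τ : Fin a ↪ Fin N), RunSelects ord x τ ∧
      (p2lPlus L h₀ φ ord (List.ofFn fun l => (x l).1)).1 =
        decision L h₀ (List.ofFn fun i => (x (τ i)).1) ∧
      (p2lPlus L h₀ φ ord (List.ofFn fun l => (x l).1)).2.1.length = a ∧
      (p2lPlus L h₀ φ ord (List.ofFn fun l => (x l).1)).2.2.length =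
        (Finset.univ.filter fun j : {j // j ∉ Set.range τ} =>
          φ (decision L h₀ (List.ofFn fun i => (x (τ i)).1)) (x j).1 = 0).card := by
  classical
  obtain ⟨I, hI, hT, hnext, hloop⟩ := exists_trace L h₀ ord x N [] List.nodup_nil
    (by intro I₁ i I₂ h; simp at h) (by simp)
  have hτ : (List.ofFn fun i => (x (I.get i)).1) = I.map fun l => (x l).1 := by
    conv_rhs => rw [← List.ofFn_get I]
    rw [List.map_ofFn]
    rfl
  have hpre : ∀ s : Fin I.length, pre (fun i => x (I.get i)) s =
      (I.take s).map fun l => (x l).1 := by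
    intro s
    unfold pre
    apply List.ext_getElem
    · simp [s.2.le]
    · intro i h1 h2
      simp
  have hsplit : ∀ s : Fin I.length, I = I.take s ++ I.get s :: I.drop (s + 1) := by
    intro s
    simp
  have hrange : ∀ j, j ∈ Set.range I.get ↔ j ∈ I := by
    intro j
    rw [List.mem_iff_get]
    rfl
  have hout : p2lPlus L h₀ φ ord (List.ofFn fun l => (x l).1) =
      (decision L h₀ (I.map fun l => (x l).1), I.map fun l => (x l).1,
        ((List.ofFn fun l => (x l).1).diff (I.map fun l => (x l).1)).filter
          (fun y => φ (decision L h₀ (I.map fun l => (x l).1)) y = 0)) := by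
    rw [p2lPlus]
    change loop L ord (List.ofFn fun l => (x l).1) h₀ [] = _ at hloop
    rw [hloop]
  refine ⟨I.length, ⟨I.get, List.nodup_iff_injective_get.1 hI⟩, ⟨?_, ?_⟩, ?_, ?_, ?_⟩
  · intro s
    obtain ⟨h1, h2⟩ := hT _ _ _ (hsplit s)
    change (ord (pre (fun i => x (I.get i)) s)).le none (some (x (I.get s)).1) ∧
      ∀ s', s < s' → MarkedLE (ord (pre (fun i => x (I.get i)) s)) (x (I.get s')) (x (I.get s))
    rw [hpre]
    refine ⟨h1, fun s' hs' => h2 _ fun hmem => ?_⟩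
    obtain ⟨u, hu, hu'⟩ := List.mem_iff_getElem.1 hmem
    rw [List.getElem_take] at hu'
    rw [List.length_take] at hu
    have := (List.nodup_iff_injective_get.1 hI) (a₁ := ⟨u, by omega⟩) (a₂ := s') hu'
    have := congrArg Fin.val this
    have h3 : s.val < s'.val := hs'
    simp only at this
    omega
  · rintro ⟨j, hj⟩
    have hj' : j ∉ I := fun h => hj ((hrange j).2 h)
    simp only [Function.Embedding.coeFn_mk]
    refine ⟨fun s => ?_, ?_⟩
    · rw [hpre]
      exact (hT _ _ _ (hsplit s)).2 j fun h => hj' (List.mem_of_mem_take h)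
    · rw [hτ]
      exact hnext j hj'
  · rw [hout]
    simp only [Function.Embedding.coeFn_mk]
    rw [hτ]
  · rw [hout]
    simp
  · rw [hout]
    simp only [Function.Embedding.coeFn_mk]
    rw [hτ, ((ofFn_diff_map_perm (fun l => (x l).1) hI).filter _).length_eq,
      List.filter_map, List.length_map, List.filter_filter,
      ← List.toFinset_card_of_nodup ((List.nodup_finRange N).filter _)]
    symm
    refine Finset.card_bij (fun (j : {j // j ∉ Set.range I.get}) _ => (j : Fin N)) ?_ ?_ ?_
    · rintro ⟨j, hj⟩ h
      have hj' : j ∉ I := fun h => hj ((hrange j).2 h)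
      simpa [hj'] using h
    · intro j _ j' _ h
      exact Subtype.ext h
    · intro j hj
      simp at hj
      exact ⟨⟨j, fun h => hj.2 ((hrange j).1 h)⟩, by simpa using hj.1, rfl⟩

end Run

/-! ### Measurability of selection, rejection and violation. -/

section Measurability

variable {Z H : Type*} [MeasurableSpace Z]

theorem measurableSet_markedLE {ord : List Z → LinearOrder (Option Z)}
    (hord : ∀ k : ℕ, MeasurableSet
      {p : (Fin k → Z) × Z × Z | (ord (List.ofFn p.1)).le (some p.2.1) (some p.2.2)})
    {α : Type*} [MeasurableSpace α] {k : ℕ} {t : α → Fin k → Z} {u v : α → Z × ℝ}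
    (ht : Measurable t) (hu : Measurable u) (hv : Measurable v) :
    MeasurableSet {w | MarkedLE (ord (List.ofFn (t w))) (u w) (v w)} := by
  have h1 := (by fun_prop : Measurable fun w => (t w, (u w).1, (v w).1)) (hord k)
  have h2 := (by fun_prop : Measurable fun w => (t w, (v w).1, (u w).1)) (hord k)
  have h3 : MeasurableSet {w | (u w).2 ≤ (v w).2} :=
    measurableSet_le (by fun_prop) (by fun_prop)
  refine h1.inter (?_ : MeasurableSet {w | _ → _})
  simp only [imp_iff_not_or, Set.ofPred_or]
  exact h2.compl.union h3

theorem measurableSet_selects {ord : List Z → LinearOrder (Option Z)}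
    (hord : ∀ k : ℕ, MeasurableSet
      {p : (Fin k → Z) × Z × Z | (ord (List.ofFn p.1)).le (some p.2.1) (some p.2.2)})
    (hthreshold : ∀ k : ℕ, MeasurableSet
      {p : (Fin k → Z) × Z | (ord (List.ofFn p.1)).le none (some p.2)}) (a : ℕ) :
    MeasurableSet {t : Fin a → Z × ℝ | Selects ord t} := by
  simp only [Selects, pre, Set.ofPred_forall, Set.ofPred_and]
  refine MeasurableSet.iInter fun s => MeasurableSet.inter ?_ (MeasurableSet.iInter fun s' =>
    MeasurableSet.iInter fun _ => ?_)
  · exact (by fun_prop : Measurable fun t : Fin a → Z × ℝ =>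
      ((fun i : Fin s => (t ⟨i, i.2.trans s.2⟩).1), (t s).1)) (hthreshold s)
  · exact measurableSet_markedLE hord (by fun_prop) (by fun_prop) (by fun_prop)

theorem measurableSet_rejects {ord : List Z → LinearOrder (Option Z)}
    (hord : ∀ k : ℕ, MeasurableSet
      {p : (Fin k → Z) × Z × Z | (ord (List.ofFn p.1)).le (some p.2.1) (some p.2.2)})
    (hthreshold : ∀ k : ℕ, MeasurableSet
      {p : (Fin k → Z) × Z | (ord (List.ofFn p.1)).le none (some p.2)}) (a : ℕ) :
    MeasurableSet {p : (Fin a → Z × ℝ) × (Z × ℝ) | Rejects ord p.1 p.2} := by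
  simp only [Rejects, pre, Set.ofPred_forall, Set.ofPred_and]
  refine MeasurableSet.inter (MeasurableSet.iInter fun s => ?_) (MeasurableSet.compl ?_)
  · exact measurableSet_markedLE hord (by fun_prop) (by fun_prop) (by fun_prop)
  · exact (by fun_prop : Measurable fun p : (Fin a → Z × ℝ) × (Z × ℝ) =>
      ((fun i => (p.1 i).1), p.2.1)) (hthreshold a)

theorem measurableSet_violates {L : List Z → H} {h₀ : H} {φ : H → Z → Fin 2}
    (hφ₀ : MeasurableSet {x : Z | φ h₀ x = 0})
    (hφL : ∀ k : ℕ, MeasurableSet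
      {p : (Fin k → Z) × Z | φ (L (List.ofFn p.1)) p.2 = 0}) (a : ℕ) :
    MeasurableSet {p : (Fin a → Z × ℝ) × Z |
      φ (decision L h₀ (List.ofFn fun i => (p.1 i).1)) p.2 = 0} := by
  cases a with
  | zero => simpa [decision] using measurable_snd hφ₀
  | succ a =>
    have : ∀ p : (Fin (a + 1) → Z × ℝ) × Z, decision L h₀ (List.ofFn fun i => (p.1 i).1) =
        L (List.ofFn fun i => (p.1 i).1) := by
      intro p
      rw [List.ofFn_succ]
      rfl
    simp only [this]
    exact (by fun_prop : Measurable fun p : (Fin (a + 1) → Z × ℝ) × Z =>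
      ((fun i => (p.1 i).1), p.2)) (hφL (a + 1))

end Measurability

/-! ### Total probability at size `m`, and the failure event. -/

section Bound
open scoped ENNReal

variable {Z H : Type*} [MeasurableSpace Z]

/-- Rejected points `x` with `φ(h, x) = 0` if `v` holds and `φ(h, x) ≠ 0` otherwise, where `h` is
the decision designed from `t`. -/
def rejectSet (L : List Z → H) (h₀ : H) (φ : H → Z → Fin 2)
    (ord : List Z → LinearOrder (Option Z)) (a : ℕ) (v : Prop) :
    Set ((Fin a → Z × ℝ) × (Z × ℝ)) :=
  {p | Rejects ord p.1 p.2 ∧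
    (φ (decision L h₀ (List.ofFn fun i => (p.1 i).1)) p.2.1 = 0 ↔ v)}

theorem measurableSet_rejectSet {L : List Z → H} {h₀ : H} {φ : H → Z → Fin 2}
    {ord : List Z → LinearOrder (Option Z)}
    (hφ₀ : MeasurableSet {x : Z | φ h₀ x = 0})
    (hφL : ∀ k : ℕ, MeasurableSet
      {p : (Fin k → Z) × Z | φ (L (List.ofFn p.1)) p.2 = 0})
    (hord : ∀ k : ℕ, MeasurableSet
      {p : (Fin k → Z) × Z × Z | (ord (List.ofFn p.1)).le (some p.2.1) (some p.2.2)})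
    (hthreshold : ∀ k : ℕ, MeasurableSet
      {p : (Fin k → Z) × Z | (ord (List.ofFn p.1)).le none (some p.2)}) (a : ℕ) (v : Prop) :
    MeasurableSet (rejectSet L h₀ φ ord a v) := by
  have h := (by fun_prop : Measurable fun p : (Fin a → Z × ℝ) × (Z × ℝ) => (p.1, p.2.1))
    (measurableSet_violates hφ₀ hφL a)
  refine (measurableSet_rejects hord hthreshold a).inter (?_ : MeasurableSet {p | _ ↔ v})
  by_cases hv : v
  · simp only [hv, iff_true]
    exact h
  · simp only [hv, iff_false]
    exact h.compl

theorem card_compl_range {a m : ℕ} (τ : Fin a ↪ Fin m) :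
    Fintype.card {j : Fin m // j ∉ Set.range τ} = m - a := by
  rw [Fintype.card_subtype_compl]
  have : Fintype.card {j : Fin m // j ∈ Set.range τ} = a := by
    rw [← Fintype.card_congr (Equiv.ofInjective τ τ.injective), Fintype.card_fin]
  rw [this, Fintype.card_fin]

/-- The events `RunSelects`, over all injections into `Fin m`, are almost surely disjoint because
the marks are almost surely distinct. All injections from `Fin a` contribute the same integral, and
there are `m.descFactorial a` of them. -/
theorem sum_descFactorial_mul_lintegral_le_one (ν : Measure (Z × ℝ)) [IsProbabilityMeasure ν]
    (hν : ∀ c, ν (Prod.snd ⁻¹' {c}) = 0) (ord : List Z → LinearOrder (Option Z))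
    (hord : ∀ k : ℕ, MeasurableSet
      {p : (Fin k → Z) × Z × Z | (ord (List.ofFn p.1)).le (some p.2.1) (some p.2.2)})
    (hthreshold : ∀ k : ℕ, MeasurableSet
      {p : (Fin k → Z) × Z | (ord (List.ofFn p.1)).le none (some p.2)}) (n m : ℕ) :
    ∑ a ∈ Finset.range n, (m.descFactorial a : ℝ≥0∞) *
      ∫⁻ t in {t : Fin a → Z × ℝ | Selects ord t}, ν {x | Rejects ord t x} ^ (m - a)
        ∂(Measure.pi fun _ => ν) ≤ 1 := by
  classical
  have hev := fun (a : ℕ) (τ : Fin a ↪ Fin m) => pi_embedding_event ν τ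
    (measurableSet_selects hord hthreshold a)
    (C := fun _ => {p | Rejects ord p.1 p.2}) (fun _ => measurableSet_rejects hord hthreshold a)
  have key := sum_measure_le_measure_univ (μ := Measure.pi fun _ : Fin m => ν)
    (s := (Finset.range n).sigma fun a => (Finset.univ : Finset (Fin a ↪ Fin m)))
    (t := fun p => {x | RunSelects ord x p.2})
    (fun p _ => (hev p.1 p.2).1.nullMeasurableSet) (by
      intro p _ q _ hpq
      have := ae_iff.1 (ae_injective_marks Prod.snd measurable_snd hν m)
      refine measure_mono_null ?_ this
      rintro x ⟨hp, hq⟩ hx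
      exact hpq (RunSelects.unique hx hp hq))
  rw [measure_univ, Finset.sum_sigma] at key
  refine le_trans (le_of_eq ?_) key
  refine Finset.sum_congr rfl fun a _ => ?_
  have h1 : ∀ τ ∈ (Finset.univ : Finset (Fin a ↪ Fin m)),
      (Measure.pi fun _ : Fin m => ν) {x | RunSelects ord x τ} =
      ∫⁻ t in {t : Fin a → Z × ℝ | Selects ord t}, ν {x | Rejects ord t x} ^ (m - a)
        ∂(Measure.pi fun _ => ν) := by
    intro τ _
    refine (hev a τ).2.trans (lintegral_congr fun t => ?_)
    rw [Finset.prod_const, Finset.card_univ, card_compl_range]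
    rfl
  rw [Finset.sum_congr rfl h1, Finset.sum_const, Finset.card_univ, Fintype.card_embedding_eq,
    Fintype.card_fin, Fintype.card_fin, nsmul_eq_mul]

/-- The run on `x` selects the indices `τ`, the remaining indices that violate the decision are
those in `J`, and the risk exceeds its bound. -/
def exceedEvent (Pz : Measure Z) (L : List Z → H) (h₀ : H) (φ : H → Z → Fin 2)
    (ord : List Z → LinearOrder (Option Z)) (δ : ℝ) {N a : ℕ} (τ : Fin a ↪ Fin N)
    (J : Finset {j : Fin N // j ∉ Set.range τ}) : Set (Fin N → Z × ℝ) :=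
  {x | (fun i => x (τ i)) ∈ {t : Fin a → Z × ℝ | Selects ord t} ∩
      {t | epsBar (a + J.card) δ N < risk Pz φ (decision L h₀ (List.ofFn fun i => (t i).1))} ∧
    ∀ j, ((fun i => x (τ i)), x (j : Fin N)) ∈ rejectSet L h₀ φ ord a (j ∈ J)}

theorem mem_iUnion_exceedEvent_iff (Pz : Measure Z) (L : List Z → H) (h₀ : H) (φ : H → Z → Fin 2)
    (ord : List Z → LinearOrder (Option Z)) (δ : ℝ) {N : ℕ} (x : Fin N → Z × ℝ)
    (hx : Function.Injective fun i => (x i).2) :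
    (¬ risk Pz φ (p2lPlus L h₀ φ ord (List.ofFn fun l => (x l).1)).1 ≤
      epsBar ((p2lPlus L h₀ φ ord (List.ofFn fun l => (x l).1)).2.1.length +
        (p2lPlus L h₀ φ ord (List.ofFn fun l => (x l).1)).2.2.length) δ N) ↔
    x ∈ ⋃ a ∈ Finset.range (N + 1), ⋃ τ : Fin a ↪ Fin N, ⋃ J,
      exceedEvent Pz L h₀ φ ord δ τ J := by
  classical
  obtain ⟨a, τ, hτ, h1, h2, h3⟩ := exists_runSelects L h₀ φ ord x
  rw [h1, h2, h3, not_le]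
  simp only [Set.mem_iUnion]
  constructor
  · intro h
    have ha : a ≤ N := by simpa using Fintype.card_le_of_embedding τ
    refine ⟨a, by simpa [Nat.lt_succ_iff] using ha, τ, _, ⟨hτ.1, h⟩, fun j => ⟨hτ.2 j, ?_⟩⟩
    simp
  · rintro ⟨b, -, σ, J, ⟨hσ, h⟩, hJ⟩
    have := RunSelects.unique hx (p := ⟨a, τ⟩) (q := ⟨b, σ⟩) hτ ⟨hσ, fun j => (hJ j).1⟩
    obtain rfl : a = b := congrArg Sigma.fst this
    obtain rfl : τ = σ := by simpa using this
    have hJ' : (Finset.univ.filter fun j : {j // j ∉ Set.range τ} =>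
        φ (decision L h₀ (List.ofFn fun i => (x (τ i)).1)) (x j).1 = 0) = J := by
      ext j
      simpa using (hJ j).2
    rw [hJ']
    exact h

theorem measurableSet_risk_lt (Pz : Measure Z) [IsProbabilityMeasure Pz]
    {L : List Z → H} {h₀ : H} {φ : H → Z → Fin 2}
    (hφ₀ : MeasurableSet {x : Z | φ h₀ x = 0})
    (hφL : ∀ k : ℕ, MeasurableSet
      {p : (Fin k → Z) × Z | φ (L (List.ofFn p.1)) p.2 = 0}) (a : ℕ) (c : ℝ) :
    MeasurableSet {t : Fin a → Z × ℝ |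
      c < risk Pz φ (decision L h₀ (List.ofFn fun i => (t i).1))} :=
  measurableSet_lt measurable_const
    (measurable_measure_prodMk_left (measurableSet_violates hφ₀ hφL a)).ennreal_toReal

end Bound

/-! ### The failure probability at size `N`. -/

section Bound
open scoped ENNReal

variable {Z H : Type*}

theorem rejectSet_preimage_eq (L : List Z → H) (h₀ : H) (φ : H → Z → Fin 2)
    (ord : List Z → LinearOrder (Option Z)) {a : ℕ} (v : Prop) (t : Fin a → Z × ℝ) :
    Prod.mk t ⁻¹' rejectSet L h₀ φ ord a v = {x | Rejects ord t x} ∩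
      {x | φ (decision L h₀ (List.ofFn fun i => (t i).1)) x.1 = 0 ↔ v} := rfl

variable [MeasurableSpace Z]

theorem measure_rejectSet_add (ν : Measure (Z × ℝ)) {L : List Z → H} {h₀ : H}
    {φ : H → Z → Fin 2} {ord : List Z → LinearOrder (Option Z)} {a : ℕ}
    (hC : ∀ v, MeasurableSet (rejectSet L h₀ φ ord a v)) (t : Fin a → Z × ℝ) :
    ν (Prod.mk t ⁻¹' rejectSet L h₀ φ ord a True) +
      ν (Prod.mk t ⁻¹' rejectSet L h₀ φ ord a False) = ν {x | Rejects ord t x} := by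
  rw [← measure_union _ (measurable_prodMk_left (hC False))]
  · congr 1
    ext x
    simp only [rejectSet_preimage_eq, Set.mem_union, Set.mem_inter_iff, Set.mem_ofPred_eq]
    tauto
  · rw [Set.disjoint_left]
    intro x h1 h2
    exact h2.2.1 (h1.2.2 trivial)

theorem measure_rejectSet_false_le {Pz : Measure Z} [IsProbabilityMeasure Pz]
    {ν : Measure (Z × ℝ)} [IsProbabilityMeasure ν] (hfst : MeasurePreserving Prod.fst ν Pz)
    {L : List Z → H} {h₀ : H} {φ : H → Z → Fin 2} (ord : List Z → LinearOrder (Option Z))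
    (hφ₀ : MeasurableSet {x : Z | φ h₀ x = 0})
    (hφL : ∀ k : ℕ, MeasurableSet
      {p : (Fin k → Z) × Z | φ (L (List.ofFn p.1)) p.2 = 0}) {a : ℕ} (t : Fin a → Z × ℝ) :
    (ν (Prod.mk t ⁻¹' rejectSet L h₀ φ ord a False)).toReal ≤
      1 - risk Pz φ (decision L h₀ (List.ofFn fun i => (t i).1)) := by
  set V := {y | φ (decision L h₀ (List.ofFn fun i => (t i).1)) y = 0}
  have hV : MeasurableSet V := measurable_prodMk_left (measurableSet_violates hφ₀ hφL a)
  calc (ν (Prod.mk t ⁻¹' rejectSet L h₀ φ ord a False)).toReal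
      ≤ ν.real (Prod.fst ⁻¹' V)ᶜ := measureReal_mono fun x hx hxV => hx.2.1 hxV
    _ = 1 - Pz.real V := by
      rw [probReal_compl_eq_one_sub (hfst.measurable hV), measureReal_def,
        hfst.measure_preimage hV.nullMeasurableSet]
      rfl

theorem measure_iUnion_exceedEvent_le (Pz : Measure Z) [IsProbabilityMeasure Pz]
    (ν : Measure (Z × ℝ)) [IsProbabilityMeasure ν] (hfst : MeasurePreserving Prod.fst ν Pz)
    (hν : ∀ c, ν (Prod.snd ⁻¹' {c}) = 0)
    (L : List Z → H) (h₀ : H) (φ : H → Z → Fin 2) (ord : List Z → LinearOrder (Option Z))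
    (hφ₀ : MeasurableSet {x : Z | φ h₀ x = 0})
    (hφL : ∀ k : ℕ, MeasurableSet
      {p : (Fin k → Z) × Z | φ (L (List.ofFn p.1)) p.2 = 0})
    (hord : ∀ k : ℕ, MeasurableSet
      {p : (Fin k → Z) × Z × Z | (ord (List.ofFn p.1)).le (some p.2.1) (some p.2.2)})
    (hthreshold : ∀ k : ℕ, MeasurableSet
      {p : (Fin k → Z) × Z | (ord (List.ofFn p.1)).le none (some p.2)})
    (N : ℕ) {δ : ℝ} (hδ₀ : 0 < δ) (hδ₁ : δ < 1) :
    MeasurableSet (⋃ a ∈ Finset.range (N + 1), ⋃ τ : Fin a ↪ Fin N, ⋃ J,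
      exceedEvent Pz L h₀ φ ord δ τ J) ∧
    Measure.pi (fun _ : Fin N => ν) (⋃ a ∈ Finset.range (N + 1), ⋃ τ : Fin a ↪ Fin N, ⋃ J,
      exceedEvent Pz L h₀ φ ord δ τ J) ≤ ENNReal.ofReal δ := by
  classical
  have hC := measurableSet_rejectSet hφ₀ hφL hord hthreshold
  have hS := measurableSet_selects hord hthreshold
  have hR := fun a b : ℕ => measurableSet_risk_lt Pz hφ₀ hφL a (epsBar (a + b) δ N)
  have hev := fun (a : ℕ) (τ : Fin a ↪ Fin N) (J : Finset {j : Fin N // j ∉ Set.range τ}) =>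
    pi_embedding_event ν τ ((hS a).inter (hR a J.card))
      (C := fun j => rejectSet L h₀ φ ord a (j ∈ J)) (fun j => hC a _)
  refine ⟨Finset.measurableSet_biUnion _ fun a _ => MeasurableSet.iUnion fun τ =>
    MeasurableSet.iUnion fun J => (hev a τ J).1, ?_⟩
  let p : ∀ a, (Fin a → Z × ℝ) → ℝ≥0∞ := fun a t => ν (Prod.mk t ⁻¹' rejectSet L h₀ φ ord a True)
  let q : ∀ a, (Fin a → Z × ℝ) → ℝ≥0∞ := fun a t => ν (Prod.mk t ⁻¹' rejectSet L h₀ φ ord a False)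
  have hp : ∀ a, Measurable (p a) := fun a => measurable_measure_prodMk_left (hC a _)
  have hq : ∀ a, Measurable (q a) := fun a => measurable_measure_prodMk_left (hC a _)
  let r : ∀ a, (Fin a → Z × ℝ) → ℝ := fun a t =>
    risk Pz φ (decision L h₀ (List.ofFn fun i => (t i).1))
  let I : ℕ → ℕ → ℝ≥0∞ := fun a b =>
    ∫⁻ t in {t : Fin a → Z × ℝ | Selects ord t} ∩ {t | epsBar (a + b) δ N < r a t},
      p a t ^ b * q a t ^ (N - a - b) ∂(Measure.pi fun _ => ν)
  have hI : ∀ a τ J, Measure.pi (fun _ : Fin N => ν)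
      (exceedEvent Pz L h₀ φ ord δ (a := a) τ J) = I a J.card := by
    intro a τ J
    refine (hev a τ J).2.trans (lintegral_congr fun t => ?_)
    have : ∀ j ∈ (Finset.univ : Finset {j : Fin N // j ∉ Set.range τ}),
        ν (Prod.mk t ⁻¹' rejectSet L h₀ φ ord a (j ∈ J)) = if j ∈ J then p a t else q a t := by
      intro j _
      by_cases hj : j ∈ J <;> simp [hj, p, q]
    rw [Finset.prod_congr rfl this, Finset.prod_ite, Finset.prod_const, Finset.prod_const,
      Finset.filter_mem_eq_inter, Finset.univ_inter, Finset.filter_not, Finset.filter_mem_eq_inter,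
      Finset.univ_inter, Finset.card_sdiff_of_subset (Finset.subset_univ J), Finset.card_univ,
      card_compl_range]
  have hstep : ∀ a ∈ Finset.range (N + 1), Measure.pi (fun _ : Fin N => ν)
      (⋃ τ : Fin a ↪ Fin N, ⋃ J, exceedEvent Pz L h₀ φ ord δ τ J) ≤
      ENNReal.ofReal (δ / N) * ∑ m ∈ Finset.range N, (m.descFactorial a : ℝ≥0∞) *
        ∫⁻ t in {t : Fin a → Z × ℝ | Selects ord t}, ν {x | Rejects ord t x} ^ (m - a)
          ∂(Measure.pi fun _ => ν) := by
    intro a ha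
    have ha : a ≤ N := by rw [Finset.mem_range] at ha; omega
    calc Measure.pi (fun _ : Fin N => ν)
          (⋃ τ : Fin a ↪ Fin N, ⋃ J, exceedEvent Pz L h₀ φ ord δ τ J)
        ≤ ∑ τ : Fin a ↪ Fin N, ∑ J, Measure.pi (fun _ : Fin N => ν)
            (exceedEvent Pz L h₀ φ ord δ τ J) :=
          (measure_iUnion_fintype_le _ _).trans
            (Finset.sum_le_sum fun τ _ => measure_iUnion_fintype_le _ _)
      _ = (N.descFactorial a : ℝ≥0∞) * ∑ b ∈ Finset.range (N - a + 1),
            ((N - a).choose b : ℝ≥0∞) * I a b := by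
          have : ∀ τ ∈ (Finset.univ : Finset (Fin a ↪ Fin N)),
              ∑ J, Measure.pi (fun _ : Fin N => ν) (exceedEvent Pz L h₀ φ ord δ τ J) =
              ∑ b ∈ Finset.range (N - a + 1), ((N - a).choose b : ℝ≥0∞) * I a b := by
            intro τ _
            -- The measure depends on `J` only through its cardinality `b`, which gives the factor
            -- `(N - a).choose b`.
            rw [Finset.sum_congr rfl fun J _ => hI a τ J, ← Finset.powerset_univ,
              Finset.sum_powerset_apply_card (I a), Finset.card_univ, card_compl_range]
            exact Finset.sum_congr rfl fun b _ => nsmul_eq_mul _ _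
          rw [Finset.sum_congr rfl this, Finset.sum_const, Finset.card_univ,
            Fintype.card_embedding_eq, Fintype.card_fin, Fintype.card_fin, nsmul_eq_mul]
      _ = ∫⁻ t in {t : Fin a → Z × ℝ | Selects ord t},
            ∑ b ∈ (Finset.range (N - a + 1)).filter (fun b => epsBar (a + b) δ N < r a t),
              (N.descFactorial a : ℝ≥0∞) *
                ((N - a).choose b * (p a t ^ b * q a t ^ (N - a - b)))
            ∂(Measure.pi fun _ => ν) := by
          have hm : ∀ b, Measurable fun t => (N.descFactorial a : ℝ≥0∞) *
              ((N - a).choose b * (p a t ^ b * q a t ^ (N - a - b))) := fun b => by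
            have := hp a
            have := hq a
            fun_prop
          have : ∀ t, ∑ b ∈ (Finset.range (N - a + 1)).filter
                (fun b => epsBar (a + b) δ N < r a t), (N.descFactorial a : ℝ≥0∞) *
                  ((N - a).choose b * (p a t ^ b * q a t ^ (N - a - b))) =
              ∑ b ∈ Finset.range (N - a + 1), {t | epsBar (a + b) δ N < r a t}.indicator
                (fun t => (N.descFactorial a : ℝ≥0∞) *
                  ((N - a).choose b * (p a t ^ b * q a t ^ (N - a - b)))) t := by
            intro t
            rw [Finset.sum_filter]
            rfl
          simp only [this]
          rw [lintegral_finsetSum _ fun b _ => (hm b).indicator (hR a b), Finset.mul_sum]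
          refine Finset.sum_congr rfl fun b _ => ?_
          have hm' : Measurable fun t => p a t ^ b * q a t ^ (N - a - b) := by
            have := hp a
            have := hq a
            fun_prop
          rw [lintegral_indicator (hR a b), Measure.restrict_restrict (hR a b),
            lintegral_const_mul _ (hm'.const_mul _), lintegral_const_mul _ hm', Set.inter_comm]
      _ ≤ ∫⁻ t in {t : Fin a → Z × ℝ | Selects ord t}, ENNReal.ofReal (δ / N) *
            ∑ m ∈ Finset.range N, (m.descFactorial a : ℝ≥0∞) * (p a t + q a t) ^ (m - a)
            ∂(Measure.pi fun _ => ν) :=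
          lintegral_mono fun t => sum_descFactorial_le_ennreal hδ₀ hδ₁ (measure_ne_top _ _)
            (measure_ne_top _ _) (measure_rejectSet_false_le hfst ord hφ₀ hφL t) ha
      _ = _ := by
          have hm : ∀ m : ℕ, Measurable fun t => (p a t + q a t) ^ (m - a) := fun m => by
            have := hp a
            have := hq a
            fun_prop
          rw [lintegral_const_mul _ (Finset.measurable_fun_sum _ fun m _ => (hm m).const_mul _),
            lintegral_finsetSum _ fun m _ => (hm m).const_mul _]
          congr 1
          refine Finset.sum_congr rfl fun m _ => ?_
          rw [lintegral_const_mul _ (hm m)]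
          congr 1
          exact lintegral_congr fun t => by rw [← measure_rejectSet_add ν (hC a) t]
  calc _ ≤ ∑ a ∈ Finset.range (N + 1), _ :=
        (measure_biUnion_finset_le _ _).trans (Finset.sum_le_sum hstep)
    _ ≤ ENNReal.ofReal (δ / N) * ∑ m ∈ Finset.range N, 1 := by
        rw [← Finset.mul_sum, Finset.sum_comm]
        gcongr with m
        exact sum_descFactorial_mul_lintegral_le_one ν hν ord hord hthreshold (N + 1) m
    _ ≤ ENNReal.ofReal δ := by
        rw [Finset.sum_const, Finset.card_range, nsmul_eq_mul, mul_one, ← ENNReal.ofReal_natCast,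
          ← ENNReal.ofReal_mul (by positivity)]
        refine ENNReal.ofReal_le_ofReal ?_
        -- For `N = 0` the factor `δ / N` is 0 by convention.
        rcases Nat.eq_zero_or_pos N with rfl | hN
        · simpa using hδ₀.le
        · exact (div_mul_cancel₀ _ (by positivity)).le

end Bound

end P2L

theorem theorem2
    {Z H Ω : Type*} [MeasurableSpace Z] [MeasurableSpace Ω]
    -- the probability space, the law of a data point, and the i.i.d. sample
    (P : Measure Ω) [IsProbabilityMeasure P]
    (Pz : Measure Z) [IsProbabilityMeasure Pz]
    (N : ℕ) (z : Fin N → Ω → Z)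
    (hz : ∀ i, Measurable (z i))
    (hlaw : ∀ i, P.map (z i) = Pz)
    (hindep : iIndepFun z P)
    -- synthesis algorithm, initial decision, property, total orders on `Z ∪ {Stop}`
    (L : List Z → H) (h₀ : H) (φ : H → Z → Fin 2)
    (ord : List Z → LinearOrder (Option Z))
    -- measurability of the ingredients
    (hφ₀ : MeasurableSet {x : Z | φ h₀ x = 0})
    (hφL : ∀ k : ℕ, MeasurableSet
      {p : (Fin k → Z) × Z | φ (L (List.ofFn p.1)) p.2 = 0})
    (hord : ∀ k : ℕ, MeasurableSet
      {p : (Fin k → Z) × Z × Z | (ord (List.ofFn p.1)).le (some p.2.1) (some p.2.2)})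
    (hthreshold : ∀ k : ℕ, MeasurableSet
      {p : (Fin k → Z) × Z | (ord (List.ofFn p.1)).le none (some p.2)})
    (δ : ℝ) (hδ₀ : 0 < δ) (hδ₁ : δ < 1) :
    (∀ k < N, ∃! ε : ℝ, P2L.IsRoot k δ N ε) ∧
    1 - δ ≤ P.real {ω |
      let out := P2L.p2lPlus L h₀ φ ord (List.ofFn fun i => z i ω)
      P2L.risk Pz φ out.1 ≤ P2L.epsBar (out.2.1.length + out.2.2.length) δ N} := by
  refine ⟨fun k hk => P2L.existsUnique_isRoot hk hδ₀ hδ₁, ?_⟩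
  -- Any atomless probability law on `ℝ` would serve for the marks.
  let γ : Measure ℝ := gaussianReal 0 1
  have : NullSingletonClass γ := nullSingletonClass_gaussianReal one_ne_zero
  have hfst : MeasurePreserving Prod.fst (Pz.prod γ) Pz := measurePreserving_fst
  have hν : ∀ c, (Pz.prod γ) (Prod.snd ⁻¹' {c}) = 0 := fun c => by
    rw [(measurePreserving_snd (μ := Pz) (ν := γ)).measure_preimage
      (measurableSet_singleton c).nullMeasurableSet]
    exact measure_singleton c
  obtain ⟨hmeas, hle⟩ := P2L.measure_iUnion_exceedEvent_le Pz (Pz.prod γ) hfst hν L h₀ φ ord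
    hφ₀ hφL hord hthreshold N hδ₀ hδ₁
  set E := ⋃ a ∈ Finset.range (N + 1), ⋃ τ : Fin a ↪ Fin N, ⋃ J,
    P2L.exceedEvent Pz L h₀ φ ord δ τ J
  let B : Set (Fin N → Z) := {y | ¬ P2L.risk Pz φ (P2L.p2lPlus L h₀ φ ord (List.ofFn y)).1 ≤
    P2L.epsBar ((P2L.p2lPlus L h₀ φ ord (List.ofFn y)).2.1.length +
      (P2L.p2lPlus L h₀ φ ord (List.ofFn y)).2.2.length) δ N}
  have hB : MeasurableSet B := by
    -- The output of the algorithm ignores the marks, so any injective ones describe `B`; the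
    -- deterministic marks `i` exhibit it as a measurable preimage of `E`.
    have h1 : B = (fun (y : Fin N → Z) i => (y i, ((i : ℕ) : ℝ))) ⁻¹' E := by
      ext y
      exact P2L.mem_iUnion_exceedEvent_iff Pz L h₀ φ ord δ (fun i => (y i, ((i : ℕ) : ℝ)))
        (fun i j h => Fin.ext (Nat.cast_injective h))
    rw [h1]
    exact (by fun_prop : Measurable _) hmeas
  have hBle : Measure.pi (fun _ : Fin N => Pz) B ≤ ENNReal.ofReal δ := by
    -- For the estimate random marks are needed: `B` is lifted to marked samples, where it lies in
    -- `E` up to a null set.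
    rw [← (measurePreserving_pi (fun _ : Fin N => Pz.prod γ) (fun _ => Pz)
      (fun _ => hfst)).measure_preimage hB.nullMeasurableSet]
    refine (measure_mono_ae ?_).trans hle
    filter_upwards [P2L.ae_injective_marks Prod.snd measurable_snd hν N] with x hx hxB
    exact (P2L.mem_iUnion_exceedEvent_iff Pz L h₀ φ ord δ x hx).1 hxB
  have hy : Measurable fun ω i => z i ω := measurable_pi_lambda _ hz
  have hmap : P.map (fun ω i => z i ω) = Measure.pi fun _ => Pz := by
    rw [(iIndepFun_iff_map_fun_eq_pi_map fun i => (hz i).aemeasurable).1 hindep]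
    simp only [hlaw]
  have hPB : P.real ((fun ω i => z i ω) ⁻¹' B) ≤ δ := by
    rw [measureReal_def, ← Measure.map_apply hy hB, hmap]
    exact ENNReal.toReal_le_of_le_ofReal hδ₀.le hBle
  have hcompl := probReal_compl_eq_one_sub (μ := P) (hy hB)
  have hset : {ω | let out := P2L.p2lPlus L h₀ φ ord (List.ofFn fun i => z i ω)
      P2L.risk Pz φ out.1 ≤ P2L.epsBar (out.2.1.length + out.2.2.length) δ N} =
      ((fun ω i => z i ω) ⁻¹' B)ᶜ := by
    ext ω
    exact not_not.symm
  rw [hset, hcompl]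
  linarith
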